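/- Let $A,G,H\in\mathbb{C}^{n\times n}$ with $G$ and $H$ positive semidefinite. Write $X\ge Y$ if $X-Y$ is positive semidefinite, and for positive semidefinite $X$ put $$R_{\rm d}(X)=H+A^*X(I+GX)^{-1}A,\qquad T_X=(I+GX)^{-1}A .$$ Let $\mathbb{R}_{\ge}$ be the set of positive semidefinite $X$ with $X\ge R_{\rm d}(X)$. Assume that $\mathbb{R}_{\ge}\neq\emptyset$ and $H\neq 0$, and let $r>1$ be an integer. For triples $Y=(Y_1,Y_2,Y_3)$ and $Z=(Z_1,Z_2,Z_3)$ of $n\times n$ matrices put, with $\Delta=(I+Y_2Z_3)^{-1}$, $$F(Y,Z)=\bigl(Z_1\Delta Y_1,\; Z_2+Z_1\Delta Y_2Z_1^*,\; Y_3+Y_1^*Z_3\Delta Y_1\bigr).$$ The accelerated fixed-point iteration (AFPI) is $\widehat{\mathbb{X}}_0=(A,G,H)$ and, for $k=0,1,2,\dots$, $\widehat{\mathbb{X}}_{k+1}=F(\widehat{\mathbb{X}}_k,\mathbb{X}_k^{(r-1)})$, where $\mathbb{X}_k^{(1)}=\widehat{\mathbb{X}}_k$ and $\mathbb{X}_k^{(\ell+1)}=F(\widehat{\mathbb{X}}_k,\mathbb{X}_k^{(\ell)})$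 for $1\le\ell\le r-2$. Write $\widehat{\mathbb{X}}_k=(\widehat A_k,\widehat G_k,\widehat H_k)$. Then all inverses in the iteration exist. The equation $X=R_{\rm d}(X)$ has a minimal positive semidefinite solution $X_\star$ (a positive semidefinite solution with $X_\star\le Y$ for every positive semidefinite solution $Y$), and $\widehat H_k\to X_\star$. The set $\sigma(T_{X_\star})\cap\mathbb{D}$, where $\mathbb{D}$ is the open unit disk, is non-empty, and for every norm $\|\cdot\|$ on $\mathbb{C}^{n\times n}$ (in particular every induced one) the convergence is R-superlinear with at least order $r$, that is, $\limsup_{k\to\infty}\|\widehat H_k-X_\star\|^{1/r^k}\le\sigma$ for some $\sigma\in(0,1)$, with the rate $$\limsup_{k\to\infty}\|\widehat H_k-X_\star\|^{1/r^k}\le\max\{|\lambda|^2:\lambda\in\sigma(T_{X_\star})\cap\mathbb{D}\}.$$ For $r=2$ the iteration is the structure-preserving doubling algorithm (SDA) $$A_{k+1}=A_k(I+G_kH_k)^{-1}A_k,\quad G_{k+1}=G_k+A_k(I+G_kH_k)^{-1}G_kA_k^*,\quad H_{k+1}=H_k+A_k^*H_k(I+G_kH_k)^{-1}A_k$$ started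 at $(A_0,G_0,H_0)=(A,G,H)$. -/

import Mathlib

open Filter Topology
open scoped Matrix ComplexOrder

namespace DARE

/-- The Riccati operator `R_d(X) = H + A* X (I + G X)⁻¹ A`. For positive semidefinite `G`, `X` the
matrix `I + G X` is invertible, so the matrix inverse is a genuine one. -/
noncomputable def Rd {n : ℕ} (A G H X : Matrix (Fin n) (Fin n) ℂ) : Matrix (Fin n) (Fin n) ℂ :=
  H + Aᴴ * X * (1 + G * X)⁻¹ * A

/-- The closed-loop matrix `T_X = (I + G X)⁻¹ A`. -/
noncomputable def closedLoop {n : ℕ} (A G X : Matrix (Fin n) (Fin n) ℂ) :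
    Matrix (Fin n) (Fin n) ℂ :=
  (1 + G * X)⁻¹ * A

/-- `ℝ_≥`: the positive semidefinite `X` with `X ≥ R_d(X)` in the Loewner order. -/
def Rge {n : ℕ} (A G H : Matrix (Fin n) (Fin n) ℂ) : Set (Matrix (Fin n) (Fin n) ℂ) :=
  {X | X.PosSemidef ∧ (X - Rd A G H X).PosSemidef}

/-- `X` is the minimal positive semidefinite solution of `X = R_d(X)`: it is a positive semidefinite
solution and lies below every positive semidefinite solution in the Loewner order. -/
def IsMinimalPSDSolution {n : ℕ} (A G H X : Matrix (Fin n) (Fin n) ℂ) : Prop :=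
  X.PosSemidef ∧ X = Rd A G H X ∧
    ∀ Y : Matrix (Fin n) (Fin n) ℂ, Y.PosSemidef → Y = Rd A G H Y → (Y - X).PosSemidef

/-- A triple of `n × n` matrices `(A, G, H)`. -/
@[ext]
structure Triple (n : ℕ) where
  A : Matrix (Fin n) (Fin n) ℂ
  G : Matrix (Fin n) (Fin n) ℂ
  H : Matrix (Fin n) (Fin n) ℂ

/-- The binary operation
`F(Y, Z) = (Z₁ Δ Y₁, Z₂ + Z₁ Δ Y₂ Z₁*, Y₃ + Y₁* Z₃ Δ Y₁)` with `Δ = (I + Y₂ Z₃)⁻¹`. -/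
noncomputable def F {n : ℕ} (Y Z : Triple n) : Triple n where
  A := Z.A * (1 + Y.G * Z.H)⁻¹ * Y.A
  G := Z.G + Z.A * (1 + Y.G * Z.H)⁻¹ * Y.G * Z.Aᴴ
  H := Y.H + Y.Aᴴ * Z.H * (1 + Y.G * Z.H)⁻¹ * Y.A

/-- The inner loop started at `Y`: `inner Y j` is `Y^(j+1)`, where `Y^(1) = Y` and
`Y^(l+1) = F(Y, Y^(l))`. -/
noncomputable def inner {n : ℕ} (Y : Triple n) : ℕ → Triple n
  | 0 => Y
  | j + 1 => F Y (inner Y j)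

/-- The accelerated fixed-point iteration with parameter `r > 1`, counted from `k = 0`: it starts at
`(A, G, H)`, and the next iterate is `F(Y, Y^(r-1))` where `Y` is the current one. -/
noncomputable def afpi {n : ℕ} (r : ℕ) (A G H : Matrix (Fin n) (Fin n) ℂ) : ℕ → Triple n
  | 0 => ⟨A, G, H⟩
  | k + 1 => F (afpi r A G H k) (inner (afpi r A G H k) (r - 2))

/-- The structure-preserving doubling algorithm started at `(A, G, H)`. -/
noncomputable def sda {n : ℕ} (A G H : Matrix (Fin n) (Fin n) ℂ) : ℕ → Triple n
  | 0 => ⟨A, G, H⟩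
  | k + 1 =>
    let A' := (sda A G H k).A
    let G' := (sda A G H k).G
    let H' := (sda A G H k).H
    ⟨A' * (1 + G' * H')⁻¹ * A',
      G' + A' * (1 + G' * H')⁻¹ * G' * A'ᴴ,
      H' + A'ᴴ * H' * (1 + G' * H')⁻¹ * A'⟩

/-- `limsup_k ‖u k - L‖^(1/r^k)`, computed in the extended reals (so it always exists), for the
norm `ν`. -/
noncomputable def rootRate {n : ℕ} (ν : Seminorm ℂ (Matrix (Fin n) (Fin n) ℂ)) (r : ℕ)
    (u : ℕ → Matrix (Fin n) (Fin n) ℂ) (L : Matrix (Fin n) (Fin n) ℂ) : EReal :=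
  limsup (fun k : ℕ => (((ν (u k - L)) ^ ((1 : ℝ) / (r : ℝ) ^ k) : ℝ) : EReal)) atTop

/-- R-superlinear convergence of `u` to `L` with at least order `r`. -/
def ConvergesRSuperlinearly {n : ℕ} (ν : Seminorm ℂ (Matrix (Fin n) (Fin n) ℂ)) (r : ℕ)
    (u : ℕ → Matrix (Fin n) (Fin n) ℂ) (L : Matrix (Fin n) (Fin n) ℂ) : Prop :=
  ∃ σ : ℝ, 0 < σ ∧ σ < 1 ∧ rootRate ν r u L ≤ (σ : EReal)

/-- The set `{|z|² : z ∈ σ(T), |z| < 1}`. -/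
def stableSquares {n : ℕ} (T : Matrix (Fin n) (Fin n) ℂ) : Set ℝ :=
  {t | ∃ z ∈ spectrum ℂ T, ‖z‖ < 1 ∧ t = ‖z‖ ^ 2}

end DARE

/-!
Write `R = R_d`. The binary operation `F` composes Riccati operators: the operator of `F(Y, Z)` is
that of `Y` after that of `Z` (`DARE.Rd_F`), and closed-loop matrices multiply accordingly
(`DARE.closedLoop_F`). Hence the triple `afpi r A G H k` represents `r ^ k` steps of the plain
fixed-point iteration, and its last component is `R^[r ^ k] 0`. The iterates `X_t = R^[t] 0`
increase in the Loewner order and stay below every element of `ℝ_≥`, so they converge to the minimal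
positive semidefinite solution `X`.

For the rate, let `T` be the closed loop at `X`. A triple `(A_t, G_t, H_t)` that represents `t`
steps satisfies `X - X_t = (T ^ t)* (X + X G_t X) T ^ t`. Two facts turn this into the bound.

* `X G_t X` is bounded for a suitable choice of the triples (`DARE.exists_error_eq_and_le`). The
  kernels of `X_t` decrease, so `ker X_s = ker X` for some `s`. The triple that composes `t` steps
  with these `s` steps has the component `G_s + A_s (I + G_t H_s)⁻¹ G_t A_s*`, and
  `H_s (I + G_t H_s)⁻¹ G_t H_s ≤ H_s` bounds it on the range of `X` independently of `t`. Since
  `X_t` depends only on `t`, any triple that represents `t` steps may be used here, and no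
  associativity of `F` is required.
* `ker X` is invariant under `T`, and every eigenvalue of the map induced on `ℂⁿ / ker X` lies in
  the open unit disk (`DARE.IsEigenvalueModKer.norm_lt_one`). Otherwise the equation
  `X = H + T* (X + X G X) T` yields a vector outside `ker X` that all `X_t` annihilate.

These eigenvalues belong to `σ(T)`, and there is at least one because `X ≠ 0`. Gelfand's formula,
applied to a matrix that represents `T` modulo `ker X`, gives the stated rate. Eigenvalues of `T`
on `ker X` may lie anywhere; they do not affect the error.
-/

namespace DARE

variable {n : ℕ}

/-! ### Positive semidefinite matrices and the resolvent `(I + G X)⁻¹` -/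

open scoped MatrixOrder Matrix.Norms.L2Operator in
theorem exists_eq_conjTranspose_mul_self {X : Matrix (Fin n) (Fin n) ℂ} (hX : X.PosSemidef) :
    ∃ B : Matrix (Fin n) (Fin n) ℂ, X = Bᴴ * B :=
  CStarAlgebra.nonneg_iff_eq_star_mul_self.mp (Matrix.nonneg_iff_posSemidef.mpr hX)

theorem isUnit_one_add_mul {G X : Matrix (Fin n) (Fin n) ℂ} (hG : G.PosSemidef)
    (hX : X.PosSemidef) : IsUnit (1 + G * X) := by
  obtain ⟨B, rfl⟩ := exists_eq_conjTranspose_mul_self hX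
  rw [Matrix.isUnit_iff_isUnit_det, ← mul_assoc, Matrix.det_one_add_mul_comm, ← mul_assoc,
    ← Matrix.isUnit_iff_isUnit_det]
  exact (Matrix.PosDef.one.add_posSemidef (hG.mul_mul_conjTranspose_same B)).isUnit

theorem inv_mul_one_add_mul {G X : Matrix (Fin n) (Fin n) ℂ} (hG : G.PosSemidef)
    (hX : X.PosSemidef) : (1 + G * X)⁻¹ * (1 + G * X) = 1 :=
  Matrix.nonsing_inv_mul _ ((Matrix.isUnit_iff_isUnit_det _).mp (isUnit_one_add_mul hG hX))

theorem one_add_mul_mul_inv {G X : Matrix (Fin n) (Fin n) ℂ} (hG : G.PosSemidef)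
    (hX : X.PosSemidef) : (1 + G * X) * (1 + G * X)⁻¹ = 1 :=
  Matrix.mul_nonsing_inv _ ((Matrix.isUnit_iff_isUnit_det _).mp (isUnit_one_add_mul hG hX))

theorem conjTranspose_inv_one_add_mul {G X : Matrix (Fin n) (Fin n) ℂ} (hG : G.PosSemidef)
    (hX : X.PosSemidef) : ((1 + G * X)⁻¹)ᴴ = (1 + X * G)⁻¹ := by
  rw [Matrix.conjTranspose_nonsing_inv, Matrix.conjTranspose_add, Matrix.conjTranspose_one,
    Matrix.conjTranspose_mul, hG.1.eq, hX.1.eq]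

/-- The push-through identity. -/
theorem mul_inv_one_add_mul {G X : Matrix (Fin n) (Fin n) ℂ} (hG : G.PosSemidef)
    (hX : X.PosSemidef) : X * (1 + G * X)⁻¹ = (1 + X * G)⁻¹ * X := by
  calc X * (1 + G * X)⁻¹ = (1 + X * G)⁻¹ * (1 + X * G) * X * (1 + G * X)⁻¹ := by
        rw [inv_mul_one_add_mul hX hG, one_mul]
    _ = (1 + X * G)⁻¹ * X * ((1 + G * X) * (1 + G * X)⁻¹) := by noncomm_ring
    _ = _ := by rw [one_add_mul_mul_inv hG hX, mul_one]

theorem posSemidef_add_mul_mul {G X : Matrix (Fin n) (Fin n) ℂ} (hG : G.PosSemidef)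
    (hX : X.PosSemidef) : (X + X * G * X).PosSemidef := by
  have h := hG.mul_mul_conjTranspose_same X
  rw [hX.1.eq] at h
  exact hX.add h

theorem posSemidef_mul_inv {G X : Matrix (Fin n) (Fin n) ℂ} (hG : G.PosSemidef)
    (hX : X.PosSemidef) : (X * (1 + G * X)⁻¹).PosSemidef := by
  have h := (posSemidef_add_mul_mul hG hX).conjTranspose_mul_mul_same ((1 + G * X)⁻¹)
  have e : X + X * G * X = (1 + X * G) * X := by noncomm_ring
  rwa [conjTranspose_inv_one_add_mul hG hX, e, ← mul_assoc, inv_mul_one_add_mul hX hG,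
    one_mul] at h

theorem posSemidef_inv_mul {G X : Matrix (Fin n) (Fin n) ℂ} (hG : G.PosSemidef)
    (hX : X.PosSemidef) : ((1 + G * X)⁻¹ * G).PosSemidef := by
  rw [← mul_inv_one_add_mul hX hG]
  exact posSemidef_mul_inv hX hG

/-- The resolvent at `U + E` factors through the resolvent at `U`. -/
theorem inv_one_add_mul_add {G U E : Matrix (Fin n) (Fin n) ℂ} (hG : G.PosSemidef)
    (hU : U.PosSemidef) :
    (1 + G * (U + E))⁻¹ = (1 + (1 + G * U)⁻¹ * G * E)⁻¹ * (1 + G * U)⁻¹ := by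
  rw [← Matrix.mul_inv_rev]
  congr 1
  calc 1 + G * (U + E) = 1 + G * U + 1 * G * E := by noncomm_ring
    _ = 1 + G * U + ((1 + G * U) * (1 + G * U)⁻¹) * G * E := by
        rw [one_add_mul_mul_inv hG hU]
    _ = _ := by noncomm_ring

/-- The increment of `X ↦ X (I + G X)⁻¹` is congruent to an expression of the same form in the
increment of `X`; this makes the map monotone. -/
theorem add_mul_inv_sub {G U E : Matrix (Fin n) (Fin n) ℂ} (hG : G.PosSemidef)
    (hU : U.PosSemidef) (hE : E.PosSemidef) :
    (U + E) * (1 + G * (U + E))⁻¹ - U * (1 + G * U)⁻¹ =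
      (1 + U * G)⁻¹ * (E * (1 + (1 + G * U)⁻¹ * G * E)⁻¹) * (1 + G * U)⁻¹ := by
  have hUE := hU.add hE
  have h1 := inv_mul_one_add_mul hU hG
  have h2 := one_add_mul_mul_inv hG hUE
  calc _ = (1 + U * G)⁻¹ * (1 + U * G) * (U + E) * (1 + G * (U + E))⁻¹
        - (1 + U * G)⁻¹ * U * ((1 + G * (U + E)) * (1 + G * (U + E))⁻¹) := by
          rw [h1, h2, one_mul, mul_one, mul_inv_one_add_mul hG hU]
    _ = (1 + U * G)⁻¹ * E * (1 + G * (U + E))⁻¹ := by noncomm_ring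
    _ = _ := by rw [inv_one_add_mul_add hG hU]; noncomm_ring

theorem mulVec_eq_zero_of_sub_posSemidef {X Y : Matrix (Fin n) (Fin n) ℂ} (hX : X.PosSemidef)
    (hXY : (Y - X).PosSemidef) {v : Fin n → ℂ} (hv : Y *ᵥ v = 0) : X *ᵥ v = 0 := by
  rw [← hX.dotProduct_mulVec_zero_iff]
  have h := hXY.dotProduct_mulVec_nonneg v
  rw [Matrix.sub_mulVec, hv, zero_sub, dotProduct_neg] at h
  exact le_antisymm (neg_nonneg.mp h) (hX.dotProduct_mulVec_nonneg v)

/-- Turns monotone convergence of traces into entrywise convergence of matrices. -/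
theorem norm_apply_le_re_trace {M : Matrix (Fin n) (Fin n) ℂ} (hM : M.PosSemidef)
    (i j : Fin n) : ‖M i j‖ ≤ M.trace.re := by
  have hd : ∀ k, (M k k).re ≤ M.trace.re := by
    intro k
    rw [Matrix.trace, Complex.re_sum]
    exact Finset.single_le_sum (f := fun k => (M k k).re)
      (fun i _ => (Complex.nonneg_iff.mp hM.diag_nonneg).1) (Finset.mem_univ k)
  obtain ⟨B, rfl⟩ := exists_eq_conjTranspose_mul_self hM
  have hdiag : ∀ k, ((Bᴴ * B) k k).re = ∑ l, ‖B l k‖ ^ 2 := by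
    intro k
    rw [Matrix.mul_apply, Complex.re_sum]
    refine Finset.sum_congr rfl fun l _ => ?_
    rw [Matrix.conjTranspose_apply, RCLike.star_def, Complex.conj_mul']
    norm_cast
  have key : ‖(Bᴴ * B) i j‖ ≤ ∑ l, (‖B l i‖ ^ 2 + ‖B l j‖ ^ 2) / 2 := by
    rw [Matrix.mul_apply]
    refine (norm_sum_le _ _).trans (Finset.sum_le_sum fun l _ => ?_)
    rw [Matrix.conjTranspose_apply, norm_mul, norm_star]
    nlinarith [sq_nonneg (‖B l i‖ - ‖B l j‖)]
  rw [← Finset.sum_div, Finset.sum_add_distrib, ← hdiag, ← hdiag] at key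
  linarith [hd i, hd j]

/-- A sequence of matrices that increases in the Loewner order and is bounded above converges. -/
theorem exists_tendsto_of_monotone {X : ℕ → Matrix (Fin n) (Fin n) ℂ}
    {Y : Matrix (Fin n) (Fin n) ℂ} (hmono : ∀ s t, s ≤ t → (X t - X s).PosSemidef)
    (hbdd : ∀ t, (Y - X t).PosSemidef) : ∃ L, Tendsto X atTop (𝓝 L) := by
  have hτ : Monotone fun t => (X t).trace.re := by
    intro s t hst
    have h := (Complex.nonneg_iff.mp (hmono s t hst).trace_nonneg).1
    rw [Matrix.trace_sub, Complex.sub_re] at h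
    exact sub_nonneg.mp h
  have hb : BddAbove (Set.range fun t => (X t).trace.re) := by
    refine ⟨Y.trace.re, ?_⟩
    rintro _ ⟨t, rfl⟩
    have h := (Complex.nonneg_iff.mp (hbdd t).trace_nonneg).1
    rw [Matrix.trace_sub, Complex.sub_re] at h
    exact sub_nonneg.mp h
  have hc := (tendsto_atTop_ciSup hτ hb).cauchySeq
  have hentry : ∀ i j, ∃ z, Tendsto (fun t => X t i j) atTop (𝓝 z) := by
    intro i j
    refine cauchySeq_tendsto_of_complete (Metric.cauchySeq_iff'.mpr fun ε hε => ?_)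
    obtain ⟨N, hN⟩ := Metric.cauchySeq_iff'.mp hc ε hε
    refine ⟨N, fun t ht => lt_of_le_of_lt ?_ (hN t ht)⟩
    have h := norm_apply_le_re_trace (hmono N t ht) i j
    rw [Matrix.sub_apply, Matrix.trace_sub, Complex.sub_re] at h
    rw [dist_eq_norm, Real.dist_eq]
    exact h.trans (le_abs_self _)
  choose L hL using hentry
  exact ⟨Matrix.of L, tendsto_pi_nhds.mpr fun i => tendsto_pi_nhds.mpr fun j => hL i j⟩

theorem isClosed_posSemidef : IsClosed {M : Matrix (Fin n) (Fin n) ℂ | M.PosSemidef} := by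
  have h : {M : Matrix (Fin n) (Fin n) ℂ | M.PosSemidef} =
      {M | Mᴴ = M} ∩ ⋂ v : Fin n → ℂ, {M | 0 ≤ star v ⬝ᵥ (M *ᵥ v)} := by
    ext M
    simp [Matrix.posSemidef_iff_dotProduct_mulVec, Matrix.IsHermitian]
  rw [h]
  refine (isClosed_eq (by fun_prop) (by fun_prop)).inter (isClosed_iInter fun v => ?_)
  exact isClosed_Ici.preimage (f := fun M : Matrix (Fin n) (Fin n) ℂ => star v ⬝ᵥ (M *ᵥ v))
    (by fun_prop)

/-- Every square matrix has a generalized inverse. -/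
theorem exists_mul_mul_eq_self (M : Matrix (Fin n) (Fin n) ℂ) :
    ∃ K : Matrix (Fin n) (Fin n) ℂ, M * K * M = M := by
  obtain ⟨g, hg⟩ := M.toLin'.rangeRestrict.exists_rightInverse_of_surjective
    M.toLin'.range_rangeRestrict
  obtain ⟨k, hk⟩ := LinearMap.exists_extend g
  refine ⟨LinearMap.toMatrix' k, Matrix.toLin'.injective ?_⟩
  rw [Matrix.toLin'_mul, Matrix.toLin'_mul, Matrix.toLin'_toMatrix']
  refine LinearMap.ext fun v => ?_
  have h1 := LinearMap.congr_fun hk (M.toLin'.rangeRestrict v)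
  have h2 := congrArg Subtype.val (LinearMap.congr_fun hg (M.toLin'.rangeRestrict v))
  change k (M.toLin' v) = _ at h1
  change M.toLin' (g (M.toLin'.rangeRestrict v)) = M.toLin' v at h2
  change M.toLin' (k (M.toLin' v)) = M.toLin' v
  rw [h1, h2]

/-- A matrix whose kernel contains `ker M` factors through `M`. -/
theorem exists_eq_mul_of_ker_le {M N : Matrix (Fin n) (Fin n) ℂ}
    (h : ∀ v, M *ᵥ v = 0 → N *ᵥ v = 0) : ∃ W, N = W * M := by
  obtain ⟨K, hK⟩ := exists_mul_mul_eq_self M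
  refine ⟨N * K, sub_eq_zero.mp ?_⟩
  refine Matrix.ext_of_mulVec_single fun i => ?_
  have h1 : M *ᵥ ((1 - K * M) *ᵥ Pi.single i 1) = 0 := by
    rw [Matrix.mulVec_mulVec, mul_sub, mul_one, ← mul_assoc, hK, sub_self, Matrix.zero_mulVec]
  have h2 := h _ h1
  rw [Matrix.mulVec_mulVec, mul_sub, mul_one, ← mul_assoc] at h2
  rw [h2, Matrix.zero_mulVec]

/-! ### The Riccati operator: monotonicity, fixed-point iteration, composition -/

theorem posSemidef_Rd {A G H X : Matrix (Fin n) (Fin n) ℂ} (hG : G.PosSemidef)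
    (hH : H.PosSemidef) (hX : X.PosSemidef) : (Rd A G H X).PosSemidef := by
  have h := (posSemidef_mul_inv hG hX).conjTranspose_mul_mul_same A
  rw [← mul_assoc] at h
  exact hH.add h

theorem Rd_zero (A G H : Matrix (Fin n) (Fin n) ℂ) : Rd A G H 0 = H := by
  simp [Rd]

theorem Rd_add_sub {A G H U E : Matrix (Fin n) (Fin n) ℂ} (hG : G.PosSemidef)
    (hU : U.PosSemidef) (hE : E.PosSemidef) :
    Rd A G H (U + E) - Rd A G H U =
      (closedLoop A G U)ᴴ * (E * (1 + (1 + G * U)⁻¹ * G * E)⁻¹) * closedLoop A G U := by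
  rw [closedLoop, Matrix.conjTranspose_mul, conjTranspose_inv_one_add_mul hG hU]
  calc _ = Aᴴ * ((U + E) * (1 + G * (U + E))⁻¹ - U * (1 + G * U)⁻¹) * A := by
        rw [Rd, Rd]; noncomm_ring
    _ = _ := by rw [add_mul_inv_sub hG hU hE]; noncomm_ring

theorem Rd_mono {A G H X Y : Matrix (Fin n) (Fin n) ℂ} (hG : G.PosSemidef)
    (hX : X.PosSemidef) (hXY : (Y - X).PosSemidef) :
    (Rd A G H Y - Rd A G H X).PosSemidef := by
  have h := Rd_add_sub (A := A) (H := H) hG hX hXY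
  rw [add_sub_cancel] at h
  rw [h]
  exact (posSemidef_mul_inv (posSemidef_inv_mul hG hX) hXY).conjTranspose_mul_mul_same _

theorem posSemidef_iterate_Rd {A G H X : Matrix (Fin n) (Fin n) ℂ} (hG : G.PosSemidef)
    (hH : H.PosSemidef) (hX : X.PosSemidef) (t : ℕ) : ((Rd A G H)^[t] X).PosSemidef := by
  induction t with
  | zero => exact hX
  | succ t ih => rw [Function.iterate_succ_apply']; exact posSemidef_Rd hG hH ih

theorem iterate_Rd_zero_le {A G H Y : Matrix (Fin n) (Fin n) ℂ} (hG : G.PosSemidef)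
    (hH : H.PosSemidef) (hY : Y ∈ Rge A G H) (t : ℕ) :
    (Y - (Rd A G H)^[t] 0).PosSemidef := by
  induction t with
  | zero => simpa using hY.1
  | succ t ih =>
    rw [Function.iterate_succ_apply']
    have h := hY.2.add (Rd_mono (A := A) (H := H) hG
      (posSemidef_iterate_Rd hG hH Matrix.PosSemidef.zero t) ih)
    rwa [sub_add_sub_cancel] at h

theorem iterate_Rd_zero_mono {A G H : Matrix (Fin n) (Fin n) ℂ} (hG : G.PosSemidef)
    (hH : H.PosSemidef) {s t : ℕ} (hst : s ≤ t) :
    ((Rd A G H)^[t] 0 - (Rd A G H)^[s] 0).PosSemidef := by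
  obtain ⟨d, rfl⟩ := Nat.exists_eq_add_of_le hst
  clear hst
  induction s with
  | zero =>
    simpa using posSemidef_iterate_Rd hG hH Matrix.PosSemidef.zero (0 + d)
  | succ s ih =>
    rw [Nat.succ_add, Nat.succ_eq_add_one, Function.iterate_succ_apply',
      Function.iterate_succ_apply']
    exact Rd_mono hG (posSemidef_iterate_Rd hG hH Matrix.PosSemidef.zero s) ih

theorem continuousAt_Rd {A G H X : Matrix (Fin n) (Fin n) ℂ} (hG : G.PosSemidef)
    (hX : X.PosSemidef) : ContinuousAt (Rd A G H) X := by
  have hu := (Matrix.isUnit_iff_isUnit_det _).mp (isUnit_one_add_mul hG hX)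
  have h1 : ContinuousAt (fun M : Matrix (Fin n) (Fin n) ℂ => M⁻¹) (1 + G * X) := by
    refine continuousAt_matrix_inv _ ?_
    -- matrix inversion is continuous where inversion of the determinant is
    rw [show (Ring.inverse : ℂ → ℂ) = fun z => z⁻¹ from funext fun z => Ring.inverse_eq_inv z]
    exact continuousAt_inv₀ hu.ne_zero
  have h2 : ContinuousAt (fun M : Matrix (Fin n) (Fin n) ℂ => (1 + G * M)⁻¹) X :=
    ContinuousAt.comp (g := fun M : Matrix (Fin n) (Fin n) ℂ => M⁻¹)
      (f := fun M : Matrix (Fin n) (Fin n) ℂ => 1 + G * M) h1 (by fun_prop)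
  unfold Rd
  fun_prop

/-- If `ℝ_≥` is non-empty, the fixed-point iteration started at `0` converges to the minimal
positive semidefinite solution. -/
theorem exists_isMinimalPSDSolution_tendsto {A G H : Matrix (Fin n) (Fin n) ℂ}
    (hG : G.PosSemidef) (hH : H.PosSemidef) (hR : (Rge A G H).Nonempty) :
    ∃ X, IsMinimalPSDSolution A G H X ∧ Tendsto (fun t => (Rd A G H)^[t] 0) atTop (𝓝 X) := by
  obtain ⟨Y, hY⟩ := hR
  obtain ⟨X, hX⟩ := exists_tendsto_of_monotone
    (fun s t => iterate_Rd_zero_mono (A := A) hG hH) (iterate_Rd_zero_le hG hH hY)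
  have hpsd : X.PosSemidef := isClosed_posSemidef.mem_of_tendsto hX
    (Eventually.of_forall fun t => posSemidef_iterate_Rd hG hH Matrix.PosSemidef.zero t)
  refine ⟨X, ⟨hpsd, ?_, fun Z hZ hfix => ?_⟩, hX⟩
  · refine tendsto_nhds_unique (hX.comp (tendsto_add_atTop_nat 1)) ?_
    refine ((continuousAt_Rd (A := A) (H := H) hG hpsd).tendsto.comp hX).congr fun t => ?_
    exact (Function.iterate_succ_apply' _ _ _).symm
  · have hZ' : Z ∈ Rge A G H := ⟨hZ, by rw [← hfix, sub_self]; exact Matrix.PosSemidef.zero⟩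
    exact isClosed_posSemidef.mem_of_tendsto (tendsto_const_nhds.sub hX)
      (Eventually.of_forall fun t => iterate_Rd_zero_le hG hH hZ' t)

theorem posSemidef_F_G {Y Z : Triple n} (hYG : Y.G.PosSemidef) (hZG : Z.G.PosSemidef)
    (hZH : Z.H.PosSemidef) : (F Y Z).G.PosSemidef := by
  have h := (posSemidef_inv_mul hYG hZH).mul_mul_conjTranspose_same Z.A
  rw [← mul_assoc] at h
  exact hZG.add h

theorem Rd_eq_add_closedLoop (A G H X : Matrix (Fin n) (Fin n) ℂ) :
    Rd A G H X = H + Aᴴ * X * closedLoop A G X := by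
  rw [Rd, closedLoop]; noncomm_ring

theorem Rd_sub_eq {A G H X : Matrix (Fin n) (Fin n) ℂ} (hG : G.PosSemidef)
    (hX : X.PosSemidef) :
    Rd A G H X - H = (closedLoop A G X)ᴴ * (X + X * G * X) * closedLoop A G X := by
  have h := Rd_eq_add_closedLoop A G H X
  have h2 : A = (1 + G * X) * closedLoop A G X := by
    rw [closedLoop, ← mul_assoc, one_add_mul_mul_inv hG hX, one_mul]
  have h3 : Aᴴ = (closedLoop A G X)ᴴ * (1 + X * G) := by
    conv_lhs => rw [h2]
    rw [Matrix.conjTranspose_mul, Matrix.conjTranspose_add, Matrix.conjTranspose_one,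
      Matrix.conjTranspose_mul, hG.1.eq, hX.1.eq]
  rw [h, h3]
  noncomm_ring

/-- Closed-loop matrices compose along `F`. -/
theorem closedLoop_F {Y Z : Triple n} (hYG : Y.G.PosSemidef) (hZG : Z.G.PosSemidef)
    (hZH : Z.H.PosSemidef) {X : Matrix (Fin n) (Fin n) ℂ} (hX : X.PosSemidef) :
    closedLoop (F Y Z).A (F Y Z).G X =
      closedLoop Z.A Z.G X * closedLoop Y.A Y.G (Rd Z.A Z.G Z.H X) := by
  have hE : (Z.Aᴴ * (X * (1 + Z.G * X)⁻¹) * Z.A).PosSemidef :=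
    (posSemidef_mul_inv hZG hX).conjTranspose_mul_mul_same _
  have hRd : Rd Z.A Z.G Z.H X = Z.H + Z.Aᴴ * (X * (1 + Z.G * X)⁻¹) * Z.A := by
    rw [Rd]; noncomm_ring
  have hFG : (F Y Z).G = Z.G + Z.A * ((1 + Y.G * Z.H)⁻¹ * Y.G) * Z.Aᴴ := by
    rw [F]; noncomm_ring
  have hFA : (F Y Z).A = Z.A * ((1 + Y.G * Z.H)⁻¹ * Y.A) := by
    rw [F]; noncomm_ring
  have hF := posSemidef_F_G hYG hZG hZH
  have h1 := inv_mul_one_add_mul hF hX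
  have hG' := posSemidef_inv_mul hYG hZH
  rw [closedLoop, closedLoop, closedLoop, hRd, inv_one_add_mul_add hYG hZH, hFA]
  rw [hFG] at h1 ⊢
  set G' := (1 + Y.G * Z.H)⁻¹ * Y.G
  set L := (1 + Z.G * X)⁻¹
  set E := Z.Aᴴ * (X * L) * Z.A with hEdef
  set D := (1 + Y.G * Z.H)⁻¹ * Y.A
  set W := (1 + (Z.G + Z.A * G' * Z.Aᴴ) * X)⁻¹
  have h2 : (1 + Z.G * X) * L = 1 := one_add_mul_mul_inv hZG hX
  have h3 : (1 + G' * E) * (1 + G' * E)⁻¹ = 1 := one_add_mul_mul_inv hG' hE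
  -- moves `Z.A` past the resolvent of the composed triple
  have h4 : (1 + (Z.G + Z.A * G' * Z.Aᴴ) * X) * L * Z.A = Z.A * (1 + G' * E) := by
    calc _ = (1 + Z.G * X) * L * Z.A + Z.A * G' * E := by rw [hEdef]; noncomm_ring
      _ = _ := by rw [h2]; noncomm_ring
  calc W * (Z.A * D) = W * (Z.A * ((1 + G' * E) * (1 + G' * E)⁻¹)) * D := by
        rw [h3]; noncomm_ring
    _ = W * (Z.A * (1 + G' * E)) * (1 + G' * E)⁻¹ * D := by noncomm_ring
    _ = (W * (1 + (Z.G + Z.A * G' * Z.Aᴴ) * X)) * L * Z.A * (1 + G' * E)⁻¹ * D := by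
        rw [← h4]; noncomm_ring
    _ = _ := by rw [h1]; noncomm_ring

/-- Riccati operators compose along `F`: first `Z`, then `Y`. -/
theorem Rd_F {Y Z : Triple n} (hYG : Y.G.PosSemidef) (hZG : Z.G.PosSemidef)
    (hZH : Z.H.PosSemidef) {X : Matrix (Fin n) (Fin n) ℂ} (hX : X.PosSemidef) :
    Rd (F Y Z).A (F Y Z).G (F Y Z).H X = Rd Y.A Y.G Y.H (Rd Z.A Z.G Z.H X) := by
  have hE : (Z.Aᴴ * (X * (1 + Z.G * X)⁻¹) * Z.A).PosSemidef :=
    (posSemidef_mul_inv hZG hX).conjTranspose_mul_mul_same _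
  have hRd : Rd Z.A Z.G Z.H X = Z.H + Z.Aᴴ * (X * (1 + Z.G * X)⁻¹) * Z.A := by
    rw [Rd]; noncomm_ring
  have hFH : (F Y Z).H = Rd Y.A Y.G Y.H Z.H := rfl
  have hFA : (F Y Z).A = Z.A * closedLoop Y.A Y.G Z.H := by
    rw [F, closedLoop]; noncomm_ring
  rw [Rd_eq_add_closedLoop, closedLoop_F hYG hZG hZH hX, hFH, hFA, hRd,
    ← eq_sub_iff_add_eq', Rd_add_sub hYG hZH hE]
  have hcl : ∀ E, closedLoop Y.A Y.G (Z.H + E) =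
      (1 + (1 + Y.G * Z.H)⁻¹ * Y.G * E)⁻¹ * closedLoop Y.A Y.G Z.H := fun E => by
    rw [closedLoop, closedLoop, inv_one_add_mul_add hYG hZH, mul_assoc]
  rw [hcl, Matrix.conjTranspose_mul, closedLoop.eq_1 Z.A]
  noncomm_ring

/-- The triple `Z` represents `t` steps of the fixed-point iteration `X ↦ R_d(X)`: its own Riccati
operator is the `t`-th iterate of `R_d`, and at every positive semidefinite solution its closed-loop
matrix is the `t`-th power of the original one. -/
structure RepresentsIterate (A G H : Matrix (Fin n) (Fin n) ℂ) (t : ℕ) (Z : Triple n) : Prop where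
  posSemidef_G : Z.G.PosSemidef
  posSemidef_H : Z.H.PosSemidef
  Rd_eq : ∀ X : Matrix (Fin n) (Fin n) ℂ, X.PosSemidef →
    Rd Z.A Z.G Z.H X = (Rd A G H)^[t] X
  closedLoop_eq : ∀ X : Matrix (Fin n) (Fin n) ℂ, X.PosSemidef → X = Rd A G H X →
    closedLoop Z.A Z.G X = closedLoop A G X ^ t

namespace RepresentsIterate

variable {A G H : Matrix (Fin n) (Fin n) ℂ} {s t : ℕ} {Y Z : Triple n}

theorem one (hG : G.PosSemidef) (hH : H.PosSemidef) : RepresentsIterate A G H 1 ⟨A, G, H⟩ :=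
  ⟨hG, hH, fun _ _ => rfl, fun _ _ _ => (pow_one _).symm⟩

theorem H_eq (hZ : RepresentsIterate A G H t Z) : Z.H = (Rd A G H)^[t] 0 := by
  rw [← hZ.Rd_eq 0 Matrix.PosSemidef.zero, Rd_zero]

theorem F (hY : RepresentsIterate A G H s Y) (hZ : RepresentsIterate A G H t Z) :
    RepresentsIterate A G H (s + t) (F Y Z) where
  posSemidef_G := posSemidef_F_G hY.posSemidef_G hZ.posSemidef_G hZ.posSemidef_H
  posSemidef_H := posSemidef_Rd hY.posSemidef_G hY.posSemidef_H hZ.posSemidef_H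
  Rd_eq X hX := by
    rw [Rd_F hY.posSemidef_G hZ.posSemidef_G hZ.posSemidef_H hX,
      hY.Rd_eq _ (posSemidef_Rd hZ.posSemidef_G hZ.posSemidef_H hX), hZ.Rd_eq X hX,
      Function.iterate_add_apply]
  closedLoop_eq X hX hfix := by
    have h : Rd Z.A Z.G Z.H X = X := by
      rw [hZ.Rd_eq X hX]
      exact Function.iterate_fixed hfix.symm t
    rw [closedLoop_F hY.posSemidef_G hZ.posSemidef_G hZ.posSemidef_H hX, h,
      hZ.closedLoop_eq X hX hfix, hY.closedLoop_eq X hX hfix, ← pow_add, add_comm]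

theorem inner (hY : RepresentsIterate A G H s Y) (j : ℕ) :
    RepresentsIterate A G H (s * (j + 1)) (inner Y j) := by
  induction j with
  | zero => rwa [zero_add, mul_one]
  | succ j ih =>
    have h := hY.F ih
    rwa [show s + s * (j + 1) = s * (j + 1 + 1) by ring] at h

theorem afpi (hG : G.PosSemidef) (hH : H.PosSemidef) {r : ℕ} (hr : 1 < r) (k : ℕ) :
    RepresentsIterate A G H (r ^ k) (afpi r A G H k) := by
  induction k with
  | zero => rw [pow_zero]; exact one hG hH
  | succ k ih =>
    have h := ih.F (ih.inner (r - 2))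
    obtain ⟨m, rfl⟩ := Nat.exists_eq_add_of_le hr
    rwa [show (Nat.succ 1 + m) ^ k + (Nat.succ 1 + m) ^ k * (Nat.succ 1 + m - 2 + 1) =
      (Nat.succ 1 + m) ^ (k + 1) by
        rw [show Nat.succ 1 + m - 2 = m by omega, Nat.succ_eq_add_one]; ring] at h

/-- At a solution `X`, the error of `t` steps started at `0` in terms of the closed loop. -/
theorem sub_H_eq (hZ : RepresentsIterate A G H t Z) {X : Matrix (Fin n) (Fin n) ℂ}
    (hX : X.PosSemidef) (hfix : X = Rd A G H X) :
    X - Z.H = (closedLoop A G X ^ t)ᴴ * (X + X * Z.G * X) * closedLoop A G X ^ t := by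
  have h := Rd_sub_eq (A := Z.A) (H := Z.H) hZ.posSemidef_G hX
  rwa [hZ.Rd_eq X hX, Function.iterate_fixed hfix.symm t, hZ.closedLoop_eq X hX hfix] at h

end RepresentsIterate

/-! ### The closed loop modulo the kernel of a solution -/

section Kernel

variable {A G H X : Matrix (Fin n) (Fin n) ℂ}

theorem sub_H_eq_of_fixed (hG : G.PosSemidef) (hX : X.PosSemidef) (hfix : X = Rd A G H X) :
    X - H = (closedLoop A G X)ᴴ * (X + X * G * X) * closedLoop A G X := by
  rw [← Rd_sub_eq (H := H) hG hX, ← hfix]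

theorem posSemidef_sub_H_of_fixed (hG : G.PosSemidef) (hX : X.PosSemidef)
    (hfix : X = Rd A G H X) : (X - H).PosSemidef := by
  rw [sub_H_eq_of_fixed hG hX hfix]
  exact (posSemidef_add_mul_mul hG hX).conjTranspose_mul_mul_same _

/-- The kernel of a solution is invariant under the closed loop. -/
theorem mulVec_closedLoop_eq_zero (hG : G.PosSemidef) (hH : H.PosSemidef) (hX : X.PosSemidef)
    (hfix : X = Rd A G H X) {v : Fin n → ℂ} (hv : X *ᵥ v = 0) :
    X *ᵥ (closedLoop A G X *ᵥ v) = 0 := by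
  have hM := posSemidef_add_mul_mul hG hX
  have h1 := mulVec_eq_zero_of_sub_posSemidef hH (posSemidef_sub_H_of_fixed hG hX hfix) hv
  have h2 : (X - H) *ᵥ v = 0 := by rw [Matrix.sub_mulVec, hv, h1, sub_zero]
  refine mulVec_eq_zero_of_sub_posSemidef (Y := X + X * G * X) hX ?_ ?_
  · rw [add_sub_cancel_left]
    have h := hG.mul_mul_conjTranspose_same X
    rwa [hX.1.eq] at h
  · rw [← hM.dotProduct_mulVec_zero_iff, Matrix.star_mulVec, ← Matrix.dotProduct_mulVec,
      Matrix.mulVec_mulVec, Matrix.mulVec_mulVec, ← sub_H_eq_of_fixed hG hX hfix, h2,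
      dotProduct_zero]

theorem mulVec_closedLoop_pow_eq_zero (hG : G.PosSemidef) (hH : H.PosSemidef)
    (hX : X.PosSemidef) (hfix : X = Rd A G H X) {v : Fin n → ℂ} (hv : X *ᵥ v = 0) (t : ℕ) :
    X *ᵥ ((closedLoop A G X ^ t) *ᵥ v) = 0 := by
  induction t with
  | zero => simpa using hv
  | succ t ih =>
    rw [pow_succ', ← Matrix.mulVec_mulVec]
    exact mulVec_closedLoop_eq_zero hG hH hX hfix ih

/-- An eigenvalue of the map that the closed loop `T` induces on `ℂⁿ / ker X`. The quotient is not
formed: `v` represents a non-zero class when `X v ≠ 0`, and `T v = z v` modulo `ker X` is expressed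
by `X T v = z X v`. -/
def IsEigenvalueModKer (A G X : Matrix (Fin n) (Fin n) ℂ) (z : ℂ) : Prop :=
  ∃ v, X *ᵥ v ≠ 0 ∧ X *ᵥ (closedLoop A G X *ᵥ v) = z • X *ᵥ v

/-- At the limit of the fixed-point iteration started at `0` the closed loop is stable modulo the
kernel: an eigenvector with an eigenvalue outside the open disk would be annihilated by `H` and by
all iterates, hence by their limit. -/
theorem IsEigenvalueModKer.norm_lt_one (hG : G.PosSemidef) (hH : H.PosSemidef)
    (hX : X.PosSemidef) (hfix : X = Rd A G H X)
    (hle : ∀ t, (X - (Rd A G H)^[t] 0).PosSemidef)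
    (hlim : Tendsto (fun t => (Rd A G H)^[t] 0) atTop (𝓝 X)) {z : ℂ}
    (hz : IsEigenvalueModKer A G X z) : ‖z‖ < 1 := by
  obtain ⟨v, hv, hzv⟩ := hz
  by_contra! hz1
  set T := closedLoop A G X with hT
  have hsub := sub_H_eq_of_fixed hG hX hfix
  rw [← hT] at hsub
  -- the quadratic form of `X = H + T* (X + X G X) T` at `v`
  have hX1 : star (T *ᵥ v) ⬝ᵥ (X *ᵥ (T *ᵥ v)) = star z * z * (star v ⬝ᵥ (X *ᵥ v)) := by
    have h : star (T *ᵥ v) ⬝ᵥ (X *ᵥ v) = star z * (star v ⬝ᵥ (X *ᵥ v)) := by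
      have e : star (X *ᵥ (T *ᵥ v)) = star (z • X *ᵥ v) := by rw [hzv]
      rw [Matrix.star_mulVec X, star_smul, Matrix.star_mulVec X, hX.1.eq] at e
      rw [Matrix.dotProduct_mulVec, e, smul_dotProduct, ← Matrix.dotProduct_mulVec, smul_eq_mul]
    rw [hzv, dotProduct_smul, h, smul_eq_mul]; ring
  have hX2 : star (T *ᵥ v) ⬝ᵥ ((X * G * X) *ᵥ (T *ᵥ v)) =
      star z * z * (star (X *ᵥ v) ⬝ᵥ (G *ᵥ (X *ᵥ v))) := by
    rw [← Matrix.mulVec_mulVec, ← Matrix.mulVec_mulVec, Matrix.dotProduct_mulVec, hzv,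
      show star (T *ᵥ v) ᵥ* X = star (z • X *ᵥ v) by rw [← hzv, Matrix.star_mulVec X, hX.1.eq],
      star_smul, Matrix.mulVec_smul, smul_dotProduct, dotProduct_smul, smul_eq_mul, smul_eq_mul]
    ring
  have hq : star v ⬝ᵥ (X *ᵥ v) = star v ⬝ᵥ (H *ᵥ v) + star z * z * (star v ⬝ᵥ (X *ᵥ v)) +
      star z * z * (star (X *ᵥ v) ⬝ᵥ (G *ᵥ (X *ᵥ v))) := by
    rw [← hX1, ← hX2, add_assoc, ← dotProduct_add, ← Matrix.add_mulVec, Matrix.star_mulVec T,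
      ← Matrix.dotProduct_mulVec, Matrix.mulVec_mulVec, Matrix.mulVec_mulVec, ← hsub,
      Matrix.sub_mulVec, dotProduct_sub]
    ring
  have hc : star z * z = ((‖z‖ ^ 2 : ℝ) : ℂ) := by
    rw [RCLike.star_def, Complex.conj_mul']; norm_cast
  have hqX := Complex.nonneg_iff.mp (hX.dotProduct_mulVec_nonneg v)
  have hqH := Complex.nonneg_iff.mp (hH.dotProduct_mulVec_nonneg v)
  have hqG := Complex.nonneg_iff.mp (hG.dotProduct_mulVec_nonneg (X *ᵥ v))
  have hqre := congrArg Complex.re hq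
  rw [hc, Complex.add_re, Complex.add_re, Complex.re_ofReal_mul, Complex.re_ofReal_mul] at hqre
  have hc1 : 1 ≤ ‖z‖ ^ 2 := one_le_pow₀ hz1
  -- `(1 - ‖z‖²) v* X v` is non-positive and equals `v* H v + ‖z‖² (X v)* G (X v)`
  have hHv : H *ᵥ v = 0 := by
    rw [← hH.dotProduct_mulVec_zero_iff]
    refine Complex.ext ?_ hqH.2.symm
    rw [Complex.zero_re]
    nlinarith [hqX.1, hqH.1, hqG.1, mul_nonneg (sub_nonneg.mpr hc1) hqX.1,
      mul_nonneg (sub_nonneg.mpr hc1) hqG.1]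
  have hGv : G *ᵥ (X *ᵥ v) = 0 := by
    rw [← hG.dotProduct_mulVec_zero_iff]
    refine Complex.ext ?_ hqG.2.symm
    rw [Complex.zero_re]
    nlinarith [hqX.1, hqH.1, hqG.1, mul_nonneg (sub_nonneg.mpr hc1) hqX.1,
      mul_nonneg (sub_nonneg.mpr hc1) hqG.1]
  have hAv : A *ᵥ v = T *ᵥ v := by
    have h : A = (1 + G * X) * T := by
      rw [hT, closedLoop, ← mul_assoc, one_add_mul_mul_inv hG hX, one_mul]
    conv_lhs => rw [h]
    rw [← Matrix.mulVec_mulVec, Matrix.add_mulVec, Matrix.one_mulVec, ← Matrix.mulVec_mulVec,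
      hzv, Matrix.mulVec_smul, hGv, smul_zero, add_zero]
  have hw : X *ᵥ (T *ᵥ v - z • v) = 0 := by
    rw [Matrix.mulVec_sub, hzv, Matrix.mulVec_smul, sub_self]
  -- `A v = T v` equals `z v` up to `ker X`, which lies in the kernel of every iterate
  have hiter : ∀ t, ((Rd A G H)^[t] 0) *ᵥ v = 0 := by
    intro t
    induction t with
    | zero => exact Matrix.zero_mulVec _
    | succ t ih =>
      have hpsd := posSemidef_iterate_Rd (A := A) hG hH Matrix.PosSemidef.zero t
      have h0 := mulVec_eq_zero_of_sub_posSemidef hpsd (hle t) hw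
      rw [Matrix.mulVec_sub, Matrix.mulVec_smul, ih, smul_zero, sub_zero] at h0
      rw [Function.iterate_succ_apply', Rd, mul_assoc Aᴴ, mul_inv_one_add_mul hG hpsd,
        Matrix.add_mulVec, hHv, zero_add, ← Matrix.mulVec_mulVec, ← Matrix.mulVec_mulVec,
        ← Matrix.mulVec_mulVec, hAv, h0, Matrix.mulVec_zero, Matrix.mulVec_zero]
  have hcont : Tendsto (fun t => ((Rd A G H)^[t] 0) *ᵥ v) atTop (𝓝 (X *ᵥ v)) :=
    ((show Continuous fun M : Matrix (Fin n) (Fin n) ℂ => M *ᵥ v by fun_prop).tendsto X).comp hlim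
  simp only [hiter] at hcont
  exact hv (tendsto_nhds_unique hcont tendsto_const_nhds)

theorem IsEigenvalueModKer.mem_spectrum (hG : G.PosSemidef) (hH : H.PosSemidef)
    (hX : X.PosSemidef) (hfix : X = Rd A G H X) {z : ℂ} (hz : IsEigenvalueModKer A G X z) :
    z ∈ spectrum ℂ (closedLoop A G X) := by
  obtain ⟨v, hv, hzv⟩ := hz
  rw [spectrum.mem_iff]
  intro hu
  set S := algebraMap ℂ (Matrix (Fin n) (Fin n) ℂ) z - closedLoop A G X with hS
  have hSv : ∀ w, X *ᵥ (S *ᵥ w) = z • X *ᵥ w - X *ᵥ (closedLoop A G X *ᵥ w) := by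
    intro w
    rw [hS, Matrix.sub_mulVec, Matrix.mulVec_sub, Algebra.algebraMap_eq_smul_one,
      Matrix.smul_mulVec, Matrix.one_mulVec, Matrix.mulVec_smul]
  have hinj : Function.Injective S.mulVecLin := by
    rw [Matrix.coe_mulVecLin]
    exact Matrix.mulVec_injective_iff_isUnit.mpr hu
  -- an invertible matrix that preserves `ker X` maps `ker X` onto itself
  have hmaps : ∀ w ∈ LinearMap.ker X.mulVecLin, S.mulVecLin w ∈ LinearMap.ker X.mulVecLin := by
    intro w hw
    rw [LinearMap.mem_ker, Matrix.mulVecLin_apply] at hw ⊢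
    rw [Matrix.mulVecLin_apply, hSv, hw, mulVec_closedLoop_eq_zero hG hH hX hfix hw, smul_zero,
      sub_zero]
  have hrinj : Function.Injective (S.mulVecLin.restrict hmaps) := by
    intro a b hab
    exact Subtype.ext (hinj (congrArg Subtype.val hab))
  have hmem : S *ᵥ v ∈ LinearMap.ker X.mulVecLin := by
    rw [LinearMap.mem_ker, Matrix.mulVecLin_apply, hSv, hzv, sub_self]
  obtain ⟨u, hu'⟩ := LinearMap.injective_iff_surjective.mp hrinj ⟨S *ᵥ v, hmem⟩
  have huv : (u : Fin n → ℂ) = v := hinj (congrArg Subtype.val hu')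
  exact hv (huv ▸ u.2)

theorem exists_isEigenvalueModKer (hG : G.PosSemidef) (hH : H.PosSemidef)
    (hX : X.PosSemidef) (hfix : X = Rd A G H X) (hX0 : X ≠ 0) :
    ∃ z, IsEigenvalueModKer A G X z := by
  let V := LinearMap.ker X.mulVecLin
  have hV : V ≠ ⊤ := by
    intro h
    rw [LinearMap.ker_eq_top] at h
    exact hX0 (Matrix.ext_of_mulVec_single fun i => by
      rw [Matrix.zero_mulVec]; exact LinearMap.congr_fun h (Pi.single i 1))
  have : Nontrivial ((Fin n → ℂ) ⧸ V) := Submodule.Quotient.nontrivial_iff.mpr hV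
  have hmaps : V ≤ V.comap (closedLoop A G X).mulVecLin := fun w hw =>
    mulVec_closedLoop_eq_zero hG hH hX hfix hw
  obtain ⟨z, hz⟩ := Module.End.exists_eigenvalue (V.mapQ V _ hmaps)
  obtain ⟨q, hq⟩ := hz.exists_hasEigenvector
  obtain ⟨v, rfl⟩ := V.mkQ_surjective q
  refine ⟨z, v, fun h0 => hq.2 ?_, ?_⟩
  · exact (Submodule.Quotient.mk_eq_zero V).mpr h0
  · have h := hq.apply_eq_smul
    rw [Submodule.mkQ_apply, Submodule.mapQ_apply, ← Submodule.Quotient.mk_smul,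
      Submodule.Quotient.eq] at h
    have h' : X *ᵥ (closedLoop A G X *ᵥ v - z • v) = 0 := h
    rwa [Matrix.mulVec_sub, Matrix.mulVec_smul, sub_eq_zero] at h'

theorem finite_stableSquares (T : Matrix (Fin n) (Fin n) ℂ) : (stableSquares T).Finite := by
  refine ((Matrix.finite_spectrum T).image fun z => ‖z‖ ^ 2).subset ?_
  rintro _ ⟨z, hz, -, rfl⟩
  exact ⟨z, hz, rfl⟩

end Kernel

/-! ### Boundedness of `X G_t X` -/

/-- The kernels of the iterates of `R_d` started at `0` decrease, hence become stationary, and then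
they equal the kernel of the limit. -/
theorem exists_ker_iterate_le {A G H X : Matrix (Fin n) (Fin n) ℂ} (hG : G.PosSemidef)
    (hH : H.PosSemidef) (hlim : Tendsto (fun t => (Rd A G H)^[t] 0) atTop (𝓝 X)) :
    ∃ s, 1 ≤ s ∧ ∀ v, ((Rd A G H)^[s] 0) *ᵥ v = 0 → X *ᵥ v = 0 := by
  let f : ℕ →o (Submodule ℂ (Fin n → ℂ))ᵒᵈ :=
    ⟨fun t => OrderDual.toDual (LinearMap.ker ((Rd A G H)^[t] 0).mulVecLin), fun s t hst v hv =>
      mulVec_eq_zero_of_sub_posSemidef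
        (posSemidef_iterate_Rd hG hH Matrix.PosSemidef.zero s) (iterate_Rd_zero_mono hG hH hst) hv⟩
  obtain ⟨m, hm⟩ := IsArtinian.monotone_stabilizes f
  refine ⟨m + 1, by omega, fun v hv => ?_⟩
  have h : ∀ᶠ t in atTop, ((Rd A G H)^[t] 0) *ᵥ v = 0 := by
    filter_upwards [eventually_ge_atTop (m + 1)] with t ht
    have e : LinearMap.ker ((Rd A G H)^[m + 1] 0).mulVecLin =
        LinearMap.ker ((Rd A G H)^[t] 0).mulVecLin :=
      (hm (m + 1) (by omega)).symm.trans (hm t (by omega))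
    have hv' : v ∈ LinearMap.ker ((Rd A G H)^[m + 1] 0).mulVecLin := hv
    rw [e] at hv'
    exact hv'
  have hcont : Tendsto (fun t => ((Rd A G H)^[t] 0) *ᵥ v) atTop (𝓝 (X *ᵥ v)) :=
    ((show Continuous fun M : Matrix (Fin n) (Fin n) ℂ => M *ᵥ v by fun_prop).tendsto X).comp hlim
  exact tendsto_nhds_unique (hcont.congr' h) tendsto_const_nhds

theorem exists_representsIterate {A G H : Matrix (Fin n) (Fin n) ℂ} (hG : G.PosSemidef)
    (hH : H.PosSemidef) {t : ℕ} (ht : 1 ≤ t) : ∃ Z, RepresentsIterate A G H t Z := by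
  obtain ⟨m, rfl⟩ := Nat.exists_eq_add_of_le ht
  refine ⟨inner ⟨A, G, H⟩ m, ?_⟩
  have h := (RepresentsIterate.one hG hH (A := A)).inner m
  rwa [one_mul, add_comm] at h

theorem sub_mul_inv_mul_mul {G X : Matrix (Fin n) (Fin n) ℂ} (hG : G.PosSemidef)
    (hX : X.PosSemidef) :
    X - X * ((1 + G * X)⁻¹ * G) * X = X * (1 + G * X)⁻¹ := by
  calc _ = X * ((1 + G * X)⁻¹ * (1 + G * X)) - X * ((1 + G * X)⁻¹ * G) * X := by
        rw [inv_mul_one_add_mul hG hX, mul_one]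
    _ = _ := by rw [mul_add, mul_add, mul_one]; simp only [mul_assoc]; abel

/-- Uniform bound on the error: once `ker H_s = ker X`, the estimate
`G_t (I + H_s G_t)⁻¹ ≤ H_s⁻¹` on the range of `H_s` bounds `X G X` for the triple that performs
`s` steps followed by any number of further steps. -/
theorem exists_error_eq_and_le {A G H X : Matrix (Fin n) (Fin n) ℂ} (hG : G.PosSemidef)
    (hH : H.PosSemidef) (hX : X.PosSemidef) (hfix : X = Rd A G H X)
    (hlim : Tendsto (fun t => (Rd A G H)^[t] 0) atTop (𝓝 X)) :
    ∃ B : Matrix (Fin n) (Fin n) ℂ, ∀ᶠ t in atTop, ∃ G' : Matrix (Fin n) (Fin n) ℂ,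
      G'.PosSemidef ∧ (B - (X + X * G' * X)).PosSemidef ∧
      X - (Rd A G H)^[t] 0 =
        (closedLoop A G X ^ t)ᴴ * (X + X * G' * X) * closedLoop A G X ^ t := by
  obtain ⟨s, hs, hker⟩ := exists_ker_iterate_le hG hH hlim
  obtain ⟨Z, hZ⟩ := exists_representsIterate (A := A) hG hH hs
  have hZA : Z.A = (1 + Z.G * X) * closedLoop A G X ^ s := by
    rw [← hZ.closedLoop_eq X hX hfix, closedLoop, ← mul_assoc,
      one_add_mul_mul_inv hZ.posSemidef_G hX, one_mul]
  obtain ⟨W, hW⟩ : ∃ W, X * Z.A = W * Z.H := by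
    refine exists_eq_mul_of_ker_le fun v hv => ?_
    rw [hZ.H_eq] at hv
    have e : X * Z.A = (1 + X * Z.G) * (X * closedLoop A G X ^ s) := by
      rw [hZA]; noncomm_ring
    rw [e, ← Matrix.mulVec_mulVec, ← Matrix.mulVec_mulVec,
      mulVec_closedLoop_pow_eq_zero hG hH hX hfix (hker v hv), Matrix.mulVec_zero]
  have hW' : Z.Aᴴ * X = Z.H * Wᴴ := by
    have h := congrArg Matrix.conjTranspose hW
    rwa [Matrix.conjTranspose_mul, Matrix.conjTranspose_mul, hX.1.eq,
      hZ.posSemidef_H.1.eq] at h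
  refine ⟨X + X * Z.G * X + W * Z.H * Wᴴ, ?_⟩
  filter_upwards [eventually_ge_atTop (s + 1)] with t ht
  obtain ⟨d, rfl⟩ := Nat.exists_eq_add_of_le ht
  obtain ⟨Y, hY⟩ := exists_representsIterate (A := A) hG hH (t := 1 + d) (by omega)
  have hYZ := hY.F hZ
  rw [show 1 + d + s = s + 1 + d by omega] at hYZ
  refine ⟨(F Y Z).G, hYZ.posSemidef_G, ?_, ?_⟩
  · -- `H_s - H_s (I + G_t H_s)⁻¹ G_t H_s = H_s (I + G_t H_s)⁻¹` is positive semidefinite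
    have h := (posSemidef_mul_inv hY.posSemidef_G hZ.posSemidef_H).mul_mul_conjTranspose_same W
    have h1 := sub_mul_inv_mul_mul hY.posSemidef_G hZ.posSemidef_H
    have e : X * (F Y Z).G * X = X * Z.G * X +
        W * (Z.H * ((1 + Y.G * Z.H)⁻¹ * Y.G) * Z.H) * Wᴴ := by
      calc _ = X * Z.G * X + X * Z.A * ((1 + Y.G * Z.H)⁻¹ * Y.G) * (Z.Aᴴ * X) := by
            rw [F]; simp only [mul_add, add_mul, mul_assoc]
        _ = _ := by rw [hW, hW']; simp only [mul_assoc]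
    have e2 : X + X * Z.G * X + W * Z.H * Wᴴ - (X + X * (F Y Z).G * X) =
        W * (Z.H * (1 + Y.G * Z.H)⁻¹) * Wᴴ := by
      rw [e, ← h1, mul_sub, sub_mul]
      abel
    rw [e2]
    exact h
  · rw [← hYZ.H_eq]
    exact hYZ.sub_H_eq hX hfix

/-! ### The rate of convergence -/

/-- On a finite-dimensional space every seminorm is bounded by a multiple of the norm. -/
theorem _root_.Seminorm.exists_le_mul_norm {E : Type*} [NormedAddCommGroup E] [NormedSpace ℂ E]
    [FiniteDimensional ℂ E] (ν : Seminorm ℂ E) : ∃ C, 0 < C ∧ ∀ x, ν x ≤ C * ‖x‖ := by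
  let b := Module.finBasis ℂ E
  let c : Fin (Module.finrank ℂ E) → E →L[ℂ] ℂ := fun i =>
    LinearMap.toContinuousLinearMap (b.coord i)
  refine ⟨1 + ∑ i, ‖c i‖ * ν (b i), ?_, fun x => ?_⟩
  · have : 0 ≤ ∑ i, ‖c i‖ * ν (b i) :=
      Finset.sum_nonneg fun i _ => mul_nonneg (norm_nonneg _) (apply_nonneg _ _)
    linarith
  · have h1 : ν x ≤ ∑ i, ν (c i x • b i) := by
      conv_lhs => rw [← b.sum_repr x]
      exact Finset.le_sum_of_subadditive ν (map_zero ν).le (map_add_le_add ν) _ _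
    have h2 : ∑ i, ν (c i x • b i) ≤ ∑ i, ‖c i‖ * ν (b i) * ‖x‖ := by
      refine Finset.sum_le_sum fun i _ => ?_
      rw [map_smul_eq_mul]
      calc ‖c i x‖ * ν (b i) ≤ ‖c i‖ * ‖x‖ * ν (b i) :=
            mul_le_mul_of_nonneg_right ((c i).le_opNorm x) (apply_nonneg _ _)
        _ = _ := by ring
    rw [← Finset.sum_mul] at h2
    nlinarith [norm_nonneg x]

open scoped Matrix.Norms.L2Operator MatrixOrder in
theorem norm_le_norm_of_sub_posSemidef {M B : Matrix (Fin n) (Fin n) ℂ} (hM : M.PosSemidef)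
    (hMB : (B - M).PosSemidef) : ‖M‖ ≤ ‖B‖ :=
  CStarAlgebra.norm_le_norm_of_nonneg_of_le (Matrix.nonneg_iff_posSemidef.mpr hM)
    (Matrix.le_iff.mpr hMB)

theorem mul_pow_eq_mul_pow_of_mul_mul_eq {R : Type*} [Monoid R] {X K T : R} (hK : X * K * X = X)
    (hT : X * T = X * T * K * X) (t : ℕ) : X * T ^ t = X * (K * X * T) ^ t := by
  induction t with
  | zero => rw [pow_zero, pow_zero]
  | succ t ih =>
    calc X * T ^ (t + 1) = (X * T) * T ^ t := by rw [pow_succ', mul_assoc]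
      _ = X * T * K * (X * T ^ t) := by conv_lhs => rw [hT, mul_assoc]
      _ = (X * T * K * X) * (K * X * T) ^ t := by rw [ih]; simp only [mul_assoc]
      _ = X * K * X * T * (K * X * T) ^ t := by rw [← hT, hK]
      _ = _ := by rw [pow_succ']; simp only [mul_assoc]

open scoped Matrix.Norms.L2Operator in
/-- The error is bounded by `‖N ^ t‖ ^ 2` up to a constant, where `N = K X T` represents the closed
loop `T` modulo `ker X`, with `K` a generalized inverse of `X`. -/
theorem exists_norm_error_le {A G H X : Matrix (Fin n) (Fin n) ℂ} (hG : G.PosSemidef)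
    (hH : H.PosSemidef) (hX : X.PosSemidef) (hfix : X = Rd A G H X)
    (hlim : Tendsto (fun t => (Rd A G H)^[t] 0) atTop (𝓝 X)) :
    ∃ N : Matrix (Fin n) (Fin n) ℂ,
      (∀ z ∈ spectrum ℂ N, z ≠ 0 → IsEigenvalueModKer A G X z) ∧
      ∃ C : ℝ, 0 < C ∧ ∀ᶠ t in atTop, ‖(Rd A G H)^[t] 0 - X‖ ≤ C * ‖N ^ t‖ ^ 2 := by
  obtain ⟨K, hK⟩ := exists_mul_mul_eq_self X
  obtain ⟨B, hB⟩ := exists_error_eq_and_le hG hH hX hfix hlim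
  set T := closedLoop A G X with hT
  have hXTK : X * T = X * T * K * X := by
    rw [← sub_eq_zero]
    refine Matrix.ext_of_mulVec_single fun i => ?_
    have h1 : X *ᵥ ((1 - K * X) *ᵥ Pi.single i 1) = 0 := by
      rw [Matrix.mulVec_mulVec, mul_sub, mul_one, ← mul_assoc, hK, sub_self, Matrix.zero_mulVec]
    have h2 := mulVec_closedLoop_eq_zero hG hH hX hfix h1
    rw [Matrix.mulVec_mulVec, Matrix.mulVec_mulVec, mul_sub, mul_one, ← hT] at h2
    rw [Matrix.zero_mulVec, ← h2, mul_assoc (X * T) K X]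
  have hpow := mul_pow_eq_mul_pow_of_mul_mul_eq hK hXTK
  refine ⟨K * X * T, fun z hz hz0 => ?_, ‖B‖ + 1, by positivity, ?_⟩
  · rw [← Matrix.spectrum_toLin', ← Module.End.hasEigenvalue_iff_mem_spectrum] at hz
    obtain ⟨v, hv⟩ := hz.exists_hasEigenvector
    have hv1 : (K * X * T) *ᵥ v = z • v := hv.apply_eq_smul
    refine ⟨v, fun h0 => ?_, ?_⟩
    · have h := mulVec_closedLoop_eq_zero hG hH hX hfix h0
      rw [mul_assoc, ← Matrix.mulVec_mulVec, ← Matrix.mulVec_mulVec, hT, h,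
        Matrix.mulVec_zero] at hv1
      exact (smul_ne_zero hz0 hv.2) hv1.symm
    · rw [← hT, ← Matrix.mulVec_smul, ← hv1, Matrix.mulVec_mulVec, Matrix.mulVec_mulVec,
        ← mul_assoc, ← mul_assoc, hK]
  · filter_upwards [hB] with t ht
    obtain ⟨G', hG', hle, heq⟩ := ht
    have hM := norm_le_norm_of_sub_posSemidef (posSemidef_add_mul_mul hG' hX) hle
    have hconj : (X * T ^ t)ᴴ = (T ^ t)ᴴ * X := by
      rw [Matrix.conjTranspose_mul, hX.1.eq]
    have hconj' : (X * (K * X * T) ^ t)ᴴ = ((K * X * T) ^ t)ᴴ * X := by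
      rw [Matrix.conjTranspose_mul, hX.1.eq]
    have e : X - (Rd A G H)^[t] 0 =
        ((K * X * T) ^ t)ᴴ * (X + X * G' * X) * (K * X * T) ^ t := by
      have e1 : X + X * G' * X = X * (K + G') * X := by
        rw [mul_add, add_mul, hK]
      calc _ = ((T ^ t)ᴴ * X) * (K + G') * (X * T ^ t) := by rw [heq, e1]; simp only [mul_assoc]
        _ = _ := by rw [← hconj, hpow, hconj', e1]; simp only [mul_assoc]
    rw [norm_sub_rev, e]
    refine (norm_mul_le _ _).trans ?_
    refine (mul_le_mul_of_nonneg_right (norm_mul_le _ _) (norm_nonneg _)).trans ?_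
    rw [Matrix.l2_opNorm_conjTranspose]
    calc _ = ‖X + X * G' * X‖ * ‖(K * X * T) ^ t‖ ^ 2 := by ring
      _ ≤ _ := mul_le_mul_of_nonneg_right (by linarith) (by positivity)

open scoped Matrix.Norms.L2Operator in
/-- Gelfand's formula as an upper bound for the powers. -/
theorem eventually_norm_pow_le {N : Matrix (Fin n) (Fin n) ℂ} {a : ℝ} (ha : 0 < a)
    (hN : ∀ z ∈ spectrum ℂ N, ‖z‖ < a) : ∀ᶠ t in atTop, ‖N ^ t‖ ≤ a ^ t := by
  have hrad : spectralRadius ℂ N < ENNReal.ofReal a := by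
    rcases subsingleton_or_nontrivial (Matrix (Fin n) (Fin n) ℂ) with hs | hs
    · rw [spectrum.SpectralRadius.of_subsingleton]
      exact ENNReal.ofReal_pos.mpr ha
    · obtain ⟨z, hz, hzr⟩ := spectrum.exists_nnnorm_eq_spectralRadius N
      rw [← hzr, ← enorm_eq_nnnorm, ← ofReal_norm]
      exact (ENNReal.ofReal_lt_ofReal_iff ha).mpr (hN z hz)
  filter_upwards [(spectrum.pow_norm_pow_one_div_tendsto_nhds_spectralRadius N).eventually_lt_const
    hrad, eventually_gt_atTop 0] with t ht ht0
  have h := ((ENNReal.ofReal_lt_ofReal_iff ha).mp ht).le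
  have h2 := pow_le_pow_left₀ (Real.rpow_nonneg (norm_nonneg _) _) h t
  rwa [one_div, Real.rpow_inv_natCast_pow (norm_nonneg _) ht0.ne'] at h2

theorem rootRate_le_of_eventually_le (ν : Seminorm ℂ (Matrix (Fin n) (Fin n) ℂ)) {r : ℕ}
    (hr : 1 < r) {u : ℕ → Matrix (Fin n) (Fin n) ℂ} {L : Matrix (Fin n) (Fin n) ℂ} {b C : ℝ}
    (hb : 0 ≤ b) (hC : 0 < C) (h : ∀ᶠ k in atTop, ν (u k - L) ≤ C * b ^ r ^ k) :
    rootRate ν r u L ≤ (b : EReal) := by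
  have hpow : Tendsto (fun k : ℕ => (r : ℝ) ^ k) atTop atTop :=
    tendsto_pow_atTop_atTop_of_one_lt (by exact_mod_cast hr)
  have hlim : Tendsto (fun k : ℕ => C ^ ((1 : ℝ) / (r : ℝ) ^ k) * b) atTop (𝓝 b) := by
    have h1 : Tendsto (fun k : ℕ => (1 : ℝ) / (r : ℝ) ^ k) atTop (𝓝 0) := by
      simp only [one_div]; exact tendsto_inv_atTop_zero.comp hpow
    have h2 := (Real.continuousAt_const_rpow hC.ne' (b := 0)).tendsto.comp h1
    rw [Real.rpow_zero] at h2
    simpa using h2.mul_const b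
  have hlim' : Tendsto (fun k : ℕ => ((C ^ ((1 : ℝ) / (r : ℝ) ^ k) * b : ℝ) : EReal)) atTop
      (𝓝 (b : EReal)) := (continuous_coe_real_ereal.tendsto b).comp hlim
  rw [rootRate, ← hlim'.limsup_eq]
  refine limsup_le_limsup ?_
  filter_upwards [h] with k hk
  rw [EReal.coe_le_coe_iff]
  have hrk : r ^ k ≠ 0 := pow_ne_zero _ (by omega)
  have h1 := Real.rpow_le_rpow (apply_nonneg ν _) hk
    (show (0 : ℝ) ≤ (1 : ℝ) / (r : ℝ) ^ k by positivity)
  refine h1.trans_eq ?_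
  rw [Real.mul_rpow hC.le (by positivity), one_div, ← Nat.cast_pow,
    Real.pow_rpow_inv_natCast hb hrk]

open scoped Matrix.Norms.L2Operator in
/-- The rate of convergence along the subsequence `r ^ k` of the fixed-point iteration. -/
theorem rootRate_iterate_Rd_le {A G H X : Matrix (Fin n) (Fin n) ℂ} (hG : G.PosSemidef)
    (hH : H.PosSemidef) (hX : X.PosSemidef) (hfix : X = Rd A G H X)
    (hlim : Tendsto (fun t => (Rd A G H)^[t] 0) atTop (𝓝 X)) {μ : ℝ} (hμ : 0 ≤ μ)
    (hmax : ∀ z, IsEigenvalueModKer A G X z → ‖z‖ ^ 2 ≤ μ)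
    (ν : Seminorm ℂ (Matrix (Fin n) (Fin n) ℂ)) {r : ℕ} (hr : 1 < r) :
    rootRate ν r (fun k => (Rd A G H)^[r ^ k] 0) X ≤ (μ : EReal) := by
  refine EReal.le_of_forall_lt_iff_le.mp fun c hc => ?_
  rw [EReal.coe_lt_coe_iff] at hc
  have hc0 : 0 < c := hμ.trans_lt hc
  obtain ⟨N, hN, C, hC, herr⟩ := exists_norm_error_le hG hH hX hfix hlim
  obtain ⟨D, hD, hν⟩ := ν.exists_le_mul_norm
  have hspec : ∀ z ∈ spectrum ℂ N, ‖z‖ < Real.sqrt c := by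
    intro z hz
    rcases eq_or_ne z 0 with rfl | hz0
    · rw [norm_zero]; exact Real.sqrt_pos.mpr hc0
    · exact Real.lt_sqrt_of_sq_lt ((hmax z (hN z hz hz0)).trans_lt hc)
  have hbound : ∀ᶠ t in atTop, ν ((Rd A G H)^[t] 0 - X) ≤ D * C * c ^ t := by
    filter_upwards [herr, eventually_norm_pow_le (Real.sqrt_pos.mpr hc0) hspec] with t h1 h2
    have h3 : ‖N ^ t‖ ^ 2 ≤ c ^ t := by
      refine (pow_le_pow_left₀ (norm_nonneg _) h2 2).trans_eq ?_
      rw [← pow_mul, mul_comm t 2, pow_mul, Real.sq_sqrt hc0.le]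
    calc _ ≤ D * ‖(Rd A G H)^[t] 0 - X‖ := hν _
      _ ≤ D * (C * c ^ t) := mul_le_mul_of_nonneg_left
          (h1.trans (mul_le_mul_of_nonneg_left h3 hC.le)) hD.le
      _ = _ := (mul_assoc _ _ _).symm
  exact rootRate_le_of_eventually_le ν hr hc0.le (mul_pos hD hC)
    ((tendsto_pow_atTop_atTop_of_one_lt hr).eventually hbound)

/-! ### The accelerated iteration -/

theorem afpi_H_eq {A G H : Matrix (Fin n) (Fin n) ℂ} (hG : G.PosSemidef) (hH : H.PosSemidef)
    {r : ℕ} (hr : 1 < r) (k : ℕ) : (afpi r A G H k).H = (Rd A G H)^[r ^ k] 0 :=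
  (RepresentsIterate.afpi hG hH hr k).H_eq

theorem afpi_two_eq_sda (A G H : Matrix (Fin n) (Fin n) ℂ) (k : ℕ) :
    afpi 2 A G H k = sda A G H k := by
  induction k with
  | zero => rfl
  | succ k ih => rw [afpi, ih]; rfl

end DARE

theorem theorem4p1 {n : ℕ} (A G H : Matrix (Fin n) (Fin n) ℂ)
    (hG : G.PosSemidef) (hH : H.PosSemidef) (hR : (DARE.Rge A G H).Nonempty) (hH0 : H ≠ 0)
    (r : ℕ) (hr : 1 < r) :
    -- every matrix inverted by the iteration is invertible
    (∀ k j : ℕ, j ≤ r - 2 →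
      IsUnit (1 + (DARE.afpi r A G H k).G * (DARE.inner (DARE.afpi r A G H k) j).H)) ∧
    -- convergence to the minimal positive semidefinite solution, with the rate
    (∃ Xs : Matrix (Fin n) (Fin n) ℂ, DARE.IsMinimalPSDSolution A G H Xs ∧
      Tendsto (fun k => (DARE.afpi r A G H k).H) atTop (𝓝 Xs) ∧
      ∃ μ : ℝ, IsGreatest (DARE.stableSquares (DARE.closedLoop A G Xs)) μ ∧
        ∀ ν : Seminorm ℂ (Matrix (Fin n) (Fin n) ℂ), (∀ M, ν M = 0 → M = 0) →
          DARE.ConvergesRSuperlinearly ν r (fun k => (DARE.afpi r A G H k).H) Xs ∧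
          DARE.rootRate ν r (fun k => (DARE.afpi r A G H k).H) Xs ≤ (μ : EReal)) ∧
    -- for `r = 2` the iteration is the structure-preserving doubling algorithm
    (r = 2 → ∀ k : ℕ, DARE.afpi r A G H k = DARE.sda A G H k) := by
  refine ⟨fun k j _ => ?_, ?_, ?_⟩
  · have h := DARE.RepresentsIterate.afpi (A := A) hG hH hr k
    exact DARE.isUnit_one_add_mul h.posSemidef_G (h.inner j).posSemidef_H
  · obtain ⟨X, hmin, hlim⟩ := DARE.exists_isMinimalPSDSolution_tendsto hG hH hR
    have hX := hmin.1
    have hfix := hmin.2.1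
    have hle : ∀ t, (X - (DARE.Rd A G H)^[t] 0).PosSemidef :=
      DARE.iterate_Rd_zero_le hG hH
        ⟨hX, by rw [← hfix, sub_self]; exact Matrix.PosSemidef.zero⟩
    have hX0 : X ≠ 0 := by
      rintro rfl
      rw [DARE.Rd_zero] at hfix
      exact hH0 hfix.symm
    have hmem : ∀ z, DARE.IsEigenvalueModKer A G X z →
        ‖z‖ ^ 2 ∈ DARE.stableSquares (DARE.closedLoop A G X) := fun z hz =>
      ⟨z, hz.mem_spectrum hG hH hX hfix, hz.norm_lt_one hG hH hX hfix hle hlim, rfl⟩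
    obtain ⟨z₀, hz₀⟩ := DARE.exists_isEigenvalueModKer hG hH hX hfix hX0
    obtain ⟨μ, hμ⟩ := (DARE.finite_stableSquares (DARE.closedLoop A G X)).exists_maximalFor id _
      ⟨_, hmem z₀ hz₀⟩
    have hgr : IsGreatest (DARE.stableSquares (DARE.closedLoop A G X)) μ :=
      ⟨hμ.1, fun y hy => (le_total y μ).elim id fun h => hμ.2 hy h⟩
    obtain ⟨z, -, hz1, hzμ⟩ := hgr.1
    have hμ0 : 0 ≤ μ := hzμ ▸ sq_nonneg _
    have hμ1 : μ < 1 := hzμ ▸ pow_lt_one₀ (norm_nonneg _) hz1 two_ne_zero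
    simp only [DARE.afpi_H_eq hG hH hr]
    refine ⟨X, hmin, hlim.comp (tendsto_pow_atTop_atTop_of_one_lt hr), μ, hgr, fun ν _ => ?_⟩
    have hrate := DARE.rootRate_iterate_Rd_le hG hH hX hfix hlim hμ0
      (fun z hz => hgr.2 (hmem z hz)) ν hr
    -- `μ` itself may vanish, so a midpoint serves as the witness in `(0, 1)`
    refine ⟨⟨(μ + 1) / 2, by linarith, by linarith, hrate.trans ?_⟩, hrate⟩
    exact EReal.coe_le_coe_iff.mpr (by linarith)
  · rintro rfl k
    exact DARE.afpi_two_eq_sda A G H k
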